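/- Let $n\ge 2$, $a=e^{2\pi i/n}$, and let $D=\mathrm{diag}(1,a,\dots,a^{n-1})$ and $S$ be the $n\times n$ matrix with $S_{j,j+1}=1$ for $1\le j\le n-1$, $S_{n,1}=1$ and all other entries $0$. For two elements $D,S$ of a complex Lie algebra and $1\le m,k\le n$ put $$T_m^k=(\mathrm{ad}\,D)^{k-1}(\mathrm{ad}\,S)^{m-1}(\mathrm{ad}\,D(S))\quad(m<n),\qquad T_n^k=\mathrm{ad}\,S(T_{n-1}^k).$$ (1) The matrices $D,S$ generate $\mathfrak{sl}(n)=\mathfrak{sl}(n,\mathbb C)$ as a Lie algebra. (2) The elements $D$, $S$ and $T_m^k$, $1\le k,m\le n$, with $k\ne n$ for $m=1,n$ and $k\neq 1$ for $m=n$, form a basis of $\mathfrak{sl}(n)$. (3) The following relations are a defining set of relations for these generators, i.e. $\mathfrak{sl}(n)$ is the quotient of the free complex Lie algebra on two generators $D,S$ by the ideal generated by these relations, via the isomorphism that sends the generators to the matrices $D,S$: $$(\mathrm{ad}\,D)^n(S)=(1-a)^nS,$$ $$(\mathrm{ad}\,D)^n\big((\mathrm{ad}\,S)^{m-1}(\mathrm{ad}\,D(S))\big)=(1-a^m)^n(\mathrm{ad}\,S)^{m-1}(\mathrm{ad}\,D(S))\qquad(2\le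 m\le n-1),$$ $$\mathrm{ad}\,S(T_{n-1}^1)=(-1)^{n-1}(1-a)^nD,\qquad \mathrm{ad}\,S(T_{n-1}^n)=0,$$ $$\mathrm{ad}\,S(T_n^k)=(-1)^n(1-a^k)^2(1-a^{n-1})^{k-1}(1-a)^{n-k-1}T_1^k,\qquad \mathrm{ad}\,D(T_n^k)=0\qquad(2\le k\le n-1),$$ and, for each $T_m^k$ with $2\le m\le n-1$, $1\le k\le n$, $(m,k)\ne(2,2)$, the $m-1$ relations $$(\mathrm{ad}\,S)^{s_1}\big((\mathrm{ad}\,D)^{k-1}((\mathrm{ad}\,S)^{s_2}(T_1^1))\big)=\left(\frac{1-a^k}{1-a}\right)^{s_1}\left(\frac{1-a^{s_2+1}}{1-a^m}\right)^{k-1}T_m^k,$$ where $s_1+s_2=m-1$ and $s_1=1,\dots,m-1$. -/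

import Mathlib

namespace Sylvester

/-- The primitive `n`-th root of unity `a = exp(2πi/n)`. -/
noncomputable def rootA (n : ℕ) : ℂ := Complex.exp (2 * Real.pi * Complex.I / n)

/-- The clock matrix `diag(1, a, a², …, a^(n-1))`. -/
noncomputable def clockMatrix (n : ℕ) : Matrix (Fin n) (Fin n) ℂ :=
  Matrix.diagonal fun j => rootA n ^ (j : ℕ)

/-- The cyclic shift matrix: ones on the superdiagonal and in the lower left corner. -/
def shiftMatrix (n : ℕ) : Matrix (Fin n) (Fin n) ℂ :=
  Matrix.of fun i j => if (j : ℕ) = ((i : ℕ) + 1) % n then 1 else 0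

theorem clockMatrix_mem {n : ℕ} (hn : 2 ≤ n) :
    clockMatrix n ∈ LieAlgebra.SpecialLinear.sl (Fin n) ℂ := by
  have h := (Complex.isPrimitiveRoot_exp n (by omega)).geom_sum_eq_zero (by omega)
  change (clockMatrix n).trace = 0
  rw [clockMatrix, Matrix.trace_diagonal]
  rw [Finset.sum_range] at h
  exact h

theorem shiftMatrix_mem {n : ℕ} (hn : 2 ≤ n) :
    shiftMatrix n ∈ LieAlgebra.SpecialLinear.sl (Fin n) ℂ := by
  change (shiftMatrix n).trace = 0
  refine Finset.sum_eq_zero fun i _ => ?_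
  have hi := i.isLt
  simp only [shiftMatrix, Matrix.diag_apply, Matrix.of_apply, ite_eq_right_iff, one_ne_zero,
    imp_false]
  rcases Nat.lt_or_ge ((i : ℕ) + 1) n with h | h
  · rw [Nat.mod_eq_of_lt h]; omega
  · have h2 : (i : ℕ) + 1 = n := by omega
    rw [h2, Nat.mod_self]; omega

/-- The clock matrix as an element of `sl(n)`. -/
noncomputable def clock (n : ℕ) (hn : 2 ≤ n) : LieAlgebra.SpecialLinear.sl (Fin n) ℂ :=
  ⟨clockMatrix n, clockMatrix_mem hn⟩

/-- The shift matrix as an element of `sl(n)`. -/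
def shift (n : ℕ) (hn : 2 ≤ n) : LieAlgebra.SpecialLinear.sl (Fin n) ℂ :=
  ⟨shiftMatrix n, shiftMatrix_mem hn⟩

/-- `iterAd x j y = (ad x)^j (y)`. -/
noncomputable def iterAd {L : Type*} [LieRing L] [LieAlgebra ℂ L] (x : L) (j : ℕ) (y : L) : L :=
  ((LieAlgebra.ad ℂ L x) ^ j) y

/-- The iterated brackets `T_m^k` (`1 ≤ m, k ≤ n`) of two elements `d`, `s` of a Lie algebra:
`T_m^k = (ad d)^(k-1) (ad s)^(m-1) (ad d (s))` for `m < n`, and `T_n^k = ad s (T_{n-1}^k)`. -/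
noncomputable def T {L : Type*} [LieRing L] [LieAlgebra ℂ L] (n : ℕ) (d s : L) (m k : ℕ) : L :=
  if m = n then ⁅s, iterAd d (k - 1) (iterAd s (n - 2) ⁅d, s⁆)⁆
  else iterAd d (k - 1) (iterAd s (m - 1) ⁅d, s⁆)

/-- The pairs `(m, k)` for which `T_m^k` is a member of the basis: `1 ≤ m, k ≤ n`, with
`k ≠ n` for `m = 1, n` and `k ≠ 1` for `m = n`. -/
def BasisIndex (n : ℕ) : Type :=
  {p : ℕ × ℕ // (1 ≤ p.1 ∧ p.1 ≤ n) ∧ (1 ≤ p.2 ∧ p.2 ≤ n) ∧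
    (p.1 = 1 ∨ p.1 = n → p.2 ≠ n) ∧ (p.1 = n → p.2 ≠ 1)}

/-- The two letters that generate the free Lie algebra. -/
inductive Gen : Type
  | D
  | S

/-- The family consisting of `d`, `s` and the `T_m^k` with `(m, k)` an admissible index. -/
noncomputable def basisFamily {L : Type*} [LieRing L] [LieAlgebra ℂ L] (n : ℕ) (d s : L) :
    Gen ⊕ BasisIndex n → L
  | Sum.inl Gen.D => d
  | Sum.inl Gen.S => s
  | Sum.inr p => T n d s p.1.1 p.1.2

/-- `Relation n d s l r` says that `l = r` is one of the listed relations for `d` and `s`;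
it only lists pairs (left-hand side, right-hand side) and does not assert that they agree. -/
inductive Relation {L : Type*} [LieRing L] [LieAlgebra ℂ L] (n : ℕ) (d s : L) : L → L → Prop
  | rel1 : Relation n d s (iterAd d n s) ((1 - rootA n) ^ n • s)
  | rel2 (m : ℕ) (hm : 2 ≤ m) (hm' : m ≤ n - 1) :
      Relation n d s (iterAd d n (iterAd s (m - 1) ⁅d, s⁆))
        ((1 - rootA n ^ m) ^ n • iterAd s (m - 1) ⁅d, s⁆)
  | rel3 : Relation n d s ⁅s, T n d s (n - 1) 1⁆ (((-1) ^ (n - 1) * (1 - rootA n) ^ n) • d)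
  | rel4 : Relation n d s ⁅s, T n d s (n - 1) n⁆ 0
  | rel5 (k : ℕ) (hk : 2 ≤ k) (hk' : k ≤ n - 1) :
      Relation n d s ⁅s, T n d s n k⁆
        (((-1) ^ n * (1 - rootA n ^ k) ^ 2 * (1 - rootA n ^ (n - 1)) ^ (k - 1) *
          (1 - rootA n) ^ (n - k - 1)) • T n d s 1 k)
  | rel6 (k : ℕ) (hk : 2 ≤ k) (hk' : k ≤ n - 1) :
      Relation n d s ⁅d, T n d s n k⁆ 0
  | path (m k s₁ s₂ : ℕ) (hm : 2 ≤ m) (hm' : m ≤ n - 1) (hk : 1 ≤ k) (hk' : k ≤ n)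
      (hmk : (m, k) ≠ (2, 2)) (hs : s₁ + s₂ = m - 1) (hs₁ : 1 ≤ s₁) :
      Relation n d s (iterAd s s₁ (iterAd d (k - 1) (iterAd s s₂ (T n d s 1 1))))
        ((((1 - rootA n ^ k) / (1 - rootA n)) ^ s₁ *
          ((1 - rootA n ^ (s₂ + 1)) / (1 - rootA n ^ m)) ^ (k - 1)) • T n d s m k)

/-- The ideal of the free Lie algebra on `D`, `S` generated by the elements `l - r`,
for `l = r` a listed relation between the two free generators. -/
noncomputable def relationIdeal (n : ℕ) : LieIdeal ℂ (FreeLieAlgebra ℂ Gen) :=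
  LieSubmodule.lieSpan ℂ (FreeLieAlgebra ℂ Gen)
    {x | ∃ l r, Relation n (FreeLieAlgebra.of ℂ Gen.D) (FreeLieAlgebra.of ℂ Gen.S) l r ∧
      x = l - r}

end Sylvester

/-! The clock and shift matrices `D`, `S` satisfy `S * D = a • (D * S)`, so each `T_m^k` is a
multiple of the monomial `D ^ k * S ^ m`, and the relations reduce to identities between scalars.
For `1 ≤ k, m ≤ n` the monomials are simultaneous eigenvectors of the conjugations by `S` and by
`D⁻¹`, which commute, with pairwise distinct pairs of eigenvalues `(a ^ k, a ^ m)`, hence they are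
linearly independent. Only the identity, `k = m = n`, is missing from the family, which leaves
`n ^ 2 - 1 = dim sl(n)` independent elements: a basis.

Conversely, in any Lie algebra generated by elements `d`, `s` that satisfy the relations, the span
of `d`, `s` and the `T_m^k` is stable under `ad d` and `ad s`, so it is everything. Thus the
presented algebra is spanned by a family whose image in `sl(n)` is independent, and its map onto
`sl(n)` is injective. -/

namespace Sylvester

section IteratedBrackets

variable {L M : Type*} [LieRing L] [LieAlgebra ℂ L] [LieRing M] [LieAlgebra ℂ M]

theorem iterAd_zero (x y : L) : iterAd x 0 y = y := rfl

theorem iterAd_succ (x y : L) (j : ℕ) : iterAd x (j + 1) y = ⁅x, iterAd x j y⁆ := by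
  simp [iterAd, pow_succ']

theorem iterAd_succ' (x y : L) (j : ℕ) : iterAd x (j + 1) y = iterAd x j ⁅x, y⁆ := by
  simp [iterAd, pow_succ]

theorem iterAd_smul (x : L) (j : ℕ) (c : ℂ) (y : L) : iterAd x j (c • y) = c • iterAd x j y :=
  map_smul _ c y

theorem map_iterAd (f : L →ₗ⁅ℂ⁆ M) (x y : L) (j : ℕ) :
    f (iterAd x j y) = iterAd (f x) j (f y) := by
  induction j with
  | zero => rfl
  | succ j ih => rw [iterAd_succ, iterAd_succ, LieHom.map_lie, ih]

theorem iterAd_mem {K : LieSubalgebra ℂ L} {x y : L} (hx : x ∈ K) (hy : y ∈ K) (j : ℕ) :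
    iterAd x j y ∈ K := by
  induction j with
  | zero => exact hy
  | succ j ih => rw [iterAd_succ]; exact K.lie_mem hx ih

theorem T_of_ne {n m : ℕ} (hmn : m ≠ n) (d s : L) (k : ℕ) :
    T n d s m k = iterAd d (k - 1) (iterAd s (m - 1) ⁅d, s⁆) := if_neg hmn

theorem T_self {n : ℕ} (hn : 2 ≤ n) (d s : L) (k : ℕ) :
    T n d s n k = ⁅s, T n d s (n - 1) k⁆ := by
  rw [T_of_ne (by omega : n - 1 ≠ n), Nat.sub_sub, T, if_pos rfl]

theorem T_one_one {n : ℕ} (hn : 2 ≤ n) (d s : L) : T n d s 1 1 = ⁅d, s⁆ :=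
  T_of_ne (by omega) d s 1

theorem map_T (f : L →ₗ⁅ℂ⁆ M) (n : ℕ) (d s : L) (m k : ℕ) :
    f (T n d s m k) = T n (f d) (f s) m k := by
  unfold T
  split_ifs <;> simp only [LieHom.map_lie, map_iterAd]

theorem T_mem {K : LieSubalgebra ℂ L} {d s : L} (hd : d ∈ K) (hs : s ∈ K) (n m k : ℕ) :
    T n d s m k ∈ K := by
  have h (i j : ℕ) : iterAd d j (iterAd s i ⁅d, s⁆) ∈ K :=
    iterAd_mem hd (iterAd_mem hs (K.lie_mem hd hs) i) j
  unfold T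
  split_ifs
  · exact K.lie_mem hs (h _ _)
  · exact h _ _

theorem map_basisFamily (f : L →ₗ⁅ℂ⁆ M) (n : ℕ) (d s : L) :
    f ∘ basisFamily n d s = basisFamily n (f d) (f s) := by
  funext i
  rcases i with (_ | _) | p
  · rfl
  · rfl
  · exact map_T f n d s _ _

theorem basisFamily_mem {K : LieSubalgebra ℂ L} {d s : L} (hd : d ∈ K) (hs : s ∈ K) (n : ℕ)
    (i : Gen ⊕ BasisIndex n) : basisFamily n d s i ∈ K := by
  rcases i with (_ | _) | p
  · exact hd
  · exact hs
  · exact T_mem hd hs n _ _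

theorem lieSpan_eq_top_of_span_basisFamily_eq_top {n : ℕ} {d s : L}
    (h : Submodule.span ℂ (Set.range (basisFamily n d s)) = ⊤) :
    LieSubalgebra.lieSpan ℂ L {d, s} = ⊤ := by
  have hd : d ∈ LieSubalgebra.lieSpan ℂ L {d, s} := LieSubalgebra.subset_lieSpan (by simp)
  have hs : s ∈ LieSubalgebra.lieSpan ℂ L {d, s} := LieSubalgebra.subset_lieSpan (by simp)
  have hle : Submodule.span ℂ (Set.range (basisFamily n d s)) ≤
      (LieSubalgebra.lieSpan ℂ L {d, s}).toSubmodule :=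
    Submodule.span_le.2 (Set.range_subset_iff.2 (basisFamily_mem hd hs n))
  exact eq_top_iff.2 fun x _ => hle (h ▸ Submodule.mem_top)

end IteratedBrackets

section Spanning

variable {L : Type*} [LieRing L]

theorem lie_lie_lie_comm (d s : L) : ⁅s, ⁅d, ⁅d, s⁆⁆⁆ = ⁅d, ⁅s, ⁅d, s⁆⁆⁆ := by
  rw [leibniz_lie s d, ← lie_skew s d, neg_lie, lie_self, neg_zero, zero_add]

theorem eq_top_of_forall_lie_mem {R : Type*} [CommRing R] [LieAlgebra R L] {X : Set L}
    (hX : LieSubalgebra.lieSpan R L X = ⊤) {V : Submodule R L} (hXV : X ⊆ V)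
    (hV : ∀ x ∈ X, ∀ v ∈ V, ⁅x, v⁆ ∈ V) : V = ⊤ := by
  refine Submodule.eq_top_iff'.2 fun x => ?_
  suffices x ∈ V ∧ ∀ v ∈ V, ⁅x, v⁆ ∈ V from this.1
  have hx : x ∈ LieSubalgebra.lieSpan R L X := hX ▸ LieSubalgebra.mem_top x
  induction hx using LieSubalgebra.lieSpan_induction with
  | mem x hx => exact ⟨hXV hx, hV x hx⟩
  | zero => exact ⟨V.zero_mem, fun v _ => by rw [zero_lie]; exact V.zero_mem⟩
  | add x y _ _ hx hy =>
    exact ⟨V.add_mem hx.1 hy.1, fun v hv => by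
      rw [add_lie]; exact V.add_mem (hx.2 v hv) (hy.2 v hv)⟩
  | smul c x _ hx =>
    exact ⟨V.smul_mem c hx.1, fun v hv => by rw [smul_lie]; exact V.smul_mem c (hx.2 v hv)⟩
  | lie x y _ _ hx hy =>
    exact ⟨hx.2 y hy.1, fun v hv => by
      rw [lie_lie]; exact V.sub_mem (hx.2 _ (hy.2 v hv)) (hy.2 _ (hx.2 v hv))⟩

variable [LieAlgebra ℂ L]

/-- The elements `d`, `s` of a Lie algebra satisfy all the listed relations. -/
def SatisfiesRelations (n : ℕ) (d s : L) : Prop :=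
  ∀ ⦃l r : L⦄, Relation n d s l r → l = r

variable {n m k : ℕ} {d s : L}

theorem lie_left_T (hmn : m ≠ n) (hk : 1 ≤ k) : ⁅d, T n d s m k⁆ = T n d s m (k + 1) := by
  obtain ⟨k, rfl⟩ := Nat.exists_eq_add_of_le' hk
  rw [T_of_ne hmn, T_of_ne hmn, Nat.add_sub_cancel, Nat.add_sub_cancel, iterAd_succ]

namespace SatisfiesRelations

theorem T_one_top (h : SatisfiesRelations n d s) (hn : 2 ≤ n) :
    T n d s 1 n = (1 - rootA n) ^ n • s := by
  rw [T_of_ne (by omega), Nat.sub_self, iterAd_zero, ← iterAd_succ', Nat.sub_add_cancel (by omega)]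
  exact h .rel1

theorem T_top_one (h : SatisfiesRelations n d s) (hn : 2 ≤ n) :
    T n d s n 1 = ((-1) ^ (n - 1) * (1 - rootA n) ^ n) • d := by
  rw [T_self hn]
  exact h .rel3

theorem T_top_top (h : SatisfiesRelations n d s) (hn : 2 ≤ n) : T n d s n n = 0 := by
  rw [T_self hn]
  exact h .rel4

theorem T_mem_span (h : SatisfiesRelations n d s) (hn : 2 ≤ n) (hm : 1 ≤ m) (hmn : m ≤ n)
    (hk : 1 ≤ k) (hkn : k ≤ n) :
    T n d s m k ∈ Submodule.span ℂ (Set.range (basisFamily n d s)) := by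
  have hmem (i) : basisFamily n d s i ∈ Submodule.span ℂ (Set.range (basisFamily n d s)) :=
    Submodule.subset_span ⟨i, rfl⟩
  by_cases hidx : (m = 1 ∨ m = n → k ≠ n) ∧ (m = n → k ≠ 1)
  · exact hmem (Sum.inr ⟨(m, k), ⟨hm, hmn⟩, ⟨hk, hkn⟩, hidx⟩)
  obtain ⟨rfl, rfl⟩ | ⟨rfl, rfl⟩ | ⟨rfl, rfl⟩ :
      (m = 1 ∧ k = n) ∨ (m = n ∧ k = n) ∨ (m = n ∧ k = 1) := by omega
  · rw [h.T_one_top hn]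
    exact Submodule.smul_mem _ _ (hmem (Sum.inl Gen.S))
  · rw [h.T_top_top hn]
    exact Submodule.zero_mem _
  · rw [h.T_top_one hn]
    exact Submodule.smul_mem _ _ (hmem (Sum.inl Gen.D))

theorem lie_left_T_top (h : SatisfiesRelations n d s) (hm : 1 ≤ m) (hmn : m < n) :
    ⁅d, T n d s m n⁆ = (1 - rootA n ^ m) ^ n • T n d s m 1 := by
  rw [T_of_ne hmn.ne, T_of_ne hmn.ne, ← iterAd_succ, Nat.sub_add_cancel (by omega), Nat.sub_self,
    iterAd_zero]
  rcases eq_or_ne m 1 with rfl | hm1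
  · rw [Nat.sub_self, iterAd_zero, pow_one, ← iterAd_succ', iterAd_succ, h .rel1, lie_smul]
  · exact h (.rel2 m (by omega) (by omega))

theorem exists_lie_right_T_eq_smul (h : SatisfiesRelations n d s) (hm : 1 ≤ m)
    (hmn : m + 1 < n) (hk : 1 ≤ k) (hkn : k ≤ n) :
    ∃ c : ℂ, ⁅s, T n d s m k⁆ = c • T n d s (m + 1) k := by
  by_cases hmk : m = 1 ∧ k = 2
  · obtain ⟨rfl, rfl⟩ := hmk
    -- The only instance not listed among the relations: it is the Jacobi identity.
    refine ⟨1, ?_⟩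
    rw [one_smul, T_of_ne (by omega), T_of_ne hmn.ne]
    simpa [iterAd] using lie_lie_lie_comm d s
  · have hpath := h (.path (m + 1) k 1 (m - 1) (by omega) (by omega) hk hkn
      (by simp only [ne_eq, Prod.mk.injEq]; omega) (by omega) le_rfl)
    rw [iterAd_succ, iterAd_zero, T_one_one (by omega), ← T_of_ne (by omega : m ≠ n)] at hpath
    exact ⟨_, hpath⟩

theorem lie_left_basisFamily_mem_span (h : SatisfiesRelations n d s) (hn : 2 ≤ n)
    (i : Gen ⊕ BasisIndex n) :
    ⁅d, basisFamily n d s i⁆ ∈ Submodule.span ℂ (Set.range (basisFamily n d s)) := by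
  rcases i with (_ | _) | ⟨⟨m, k⟩, ⟨hm, hmn⟩, ⟨hk, hkn⟩, hkn', hk1⟩ <;>
    simp only [basisFamily] at *
  · rw [lie_self]
    exact Submodule.zero_mem _
  · rw [← T_one_one hn]
    exact h.T_mem_span hn le_rfl (by omega) le_rfl (by omega)
  obtain rfl | hmn := hmn.eq_or_lt
  · rw [h (.rel6 k (by omega) (by omega))]
    exact Submodule.zero_mem _
  obtain rfl | hkn := hkn.eq_or_lt
  · rw [h.lie_left_T_top hm hmn]
    exact Submodule.smul_mem _ _ (h.T_mem_span hn hm hmn.le le_rfl hk)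
  · rw [lie_left_T hmn.ne hk]
    exact h.T_mem_span hn hm hmn.le (by omega) hkn

theorem lie_right_basisFamily_mem_span (h : SatisfiesRelations n d s) (hn : 2 ≤ n)
    (i : Gen ⊕ BasisIndex n) :
    ⁅s, basisFamily n d s i⁆ ∈ Submodule.span ℂ (Set.range (basisFamily n d s)) := by
  rcases i with (_ | _) | ⟨⟨m, k⟩, ⟨hm, hmn⟩, ⟨hk, hkn⟩, hkn', hk1⟩ <;>
    simp only [basisFamily] at *
  · rw [← lie_skew, ← T_one_one hn]
    exact Submodule.neg_mem _ (h.T_mem_span hn le_rfl (by omega) le_rfl (by omega))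
  · rw [lie_self]
    exact Submodule.zero_mem _
  obtain rfl | hmn := hmn.eq_or_lt
  · rw [h (.rel5 k (by omega) (by omega))]
    exact Submodule.smul_mem _ _ (h.T_mem_span hn le_rfl hm hk hkn)
  obtain rfl | hmn' := (Nat.succ_le_of_lt hmn).eq_or_lt
  · exact T_self hn d s k ▸ h.T_mem_span hn (by omega) le_rfl hk hkn
  · obtain ⟨c, hc⟩ := h.exists_lie_right_T_eq_smul hm hmn' hk hkn
    rw [hc]
    exact Submodule.smul_mem _ _ (h.T_mem_span hn (by omega) hmn hk hkn)

theorem span_basisFamily_eq_top (h : SatisfiesRelations n d s) (hn : 2 ≤ n)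
    (hgen : LieSubalgebra.lieSpan ℂ L {d, s} = ⊤) :
    Submodule.span ℂ (Set.range (basisFamily n d s)) = ⊤ := by
  set V := Submodule.span ℂ (Set.range (basisFamily n d s))
  have hstable {x : L} (hx : ∀ i, ⁅x, basisFamily n d s i⁆ ∈ V) : ∀ v ∈ V, ⁅x, v⁆ ∈ V :=
    (Submodule.span_le (p := V.comap (LieAlgebra.ad ℂ L x))).2
      (Set.range_subset_iff.2 hx)
  refine eq_top_of_forall_lie_mem hgen ?_ ?_
  · rintro x (rfl | rfl)
    · exact Submodule.subset_span ⟨Sum.inl Gen.D, rfl⟩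
    · exact Submodule.subset_span ⟨Sum.inl Gen.S, rfl⟩
  · rintro x (rfl | rfl)
    · exact hstable (h.lie_left_basisFamily_mem_span hn)
    · exact hstable (h.lie_right_basisFamily_mem_span hn)

end SatisfiesRelations

end Spanning

section Presentation

variable {R L M : Type*} [CommRing R] [LieRing L] [LieAlgebra R L] [LieRing M] [LieAlgebra R M]

theorem range_freeLieAlgebra_lift {X : Type*} (f : X → L) :
    (FreeLieAlgebra.lift R f).range = LieSubalgebra.lieSpan R L (Set.range f) := by
  refine le_antisymm ?_ (LieSubalgebra.lieSpan_le.2 ?_)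
  · let g : FreeLieAlgebra R X →ₗ⁅R⁆ LieSubalgebra.lieSpan R L (Set.range f) :=
      FreeLieAlgebra.lift R fun x => ⟨f x, LieSubalgebra.subset_lieSpan ⟨x, rfl⟩⟩
    have hg : FreeLieAlgebra.lift R f = (LieSubalgebra.incl _).comp g :=
      FreeLieAlgebra.hom_ext fun x => by simp [g]
    rintro _ ⟨x, rfl⟩
    rw [hg]
    exact (g x).2
  · rintro _ ⟨x, rfl⟩
    exact ⟨FreeLieAlgebra.of R x, FreeLieAlgebra.lift_of_apply f x⟩

/-- The projection onto the quotient by an ideal, as a morphism of Lie algebras. -/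
def quotientMk (I : LieIdeal R L) : L →ₗ⁅R⁆ L ⧸ I :=
  { (LieSubmodule.Quotient.mk' I : L →ₗ[R] L ⧸ I) with
    map_lie' := fun {x y} => LieSubmodule.Quotient.mk_bracket I x y }

theorem ker_quotientMk (I : LieIdeal R L) : (quotientMk I).ker = I := by
  ext x
  exact LieSubmodule.Quotient.mk_eq_zero I

theorem range_quotientMk (I : LieIdeal R L) : (quotientMk I).range = ⊤ :=
  (LieHom.range_eq_top _).2 (LieSubmodule.Quotient.surjective_mk' I)

theorem exists_quotient_equiv {I : LieIdeal R L} {f : L →ₗ⁅R⁆ M} (hI : I = f.ker)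
    (hf : f.range = ⊤) : ∃ e : (L ⧸ I) ≃ₗ⁅R⁆ M, ∀ x, e (LieSubmodule.Quotient.mk x) = f x := by
  subst hI
  exact ⟨f.quotKerEquivRange.trans
    ((LieEquiv.ofEq _ _ (congrArg _ hf)).trans LieSubalgebra.topEquiv), fun _ => rfl⟩

end Presentation

section RelationIdeal

variable {L M : Type*} [LieRing L] [LieAlgebra ℂ L] [LieRing M] [LieAlgebra ℂ M] {n : ℕ}

theorem Relation.map (f : L →ₗ⁅ℂ⁆ M) {d s l r : L} (h : Relation n d s l r) :
    Relation n (f d) (f s) (f l) (f r) := by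
  cases h <;> simp only [LieHom.map_lie, map_smul, map_zero, map_iterAd, map_T] <;>
    constructor <;> assumption

theorem Relation.exists_of_map (f : L →ₗ⁅ℂ⁆ M) {d s : L} {l r : M}
    (h : Relation n (f d) (f s) l r) : ∃ l' r', Relation n d s l' r' ∧ f l' = l ∧ f r' = r := by
  cases h
  case rel1 => exact ⟨_, _, .rel1, by simp only [map_iterAd], map_smul f _ _⟩
  case rel2 m hm hm' =>
    exact ⟨_, _, .rel2 m hm hm', by simp only [map_iterAd, LieHom.map_lie],
      by simp only [map_smul, map_iterAd, LieHom.map_lie]⟩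
  case rel3 => exact ⟨_, _, .rel3, by simp only [LieHom.map_lie, map_T], map_smul f _ _⟩
  case rel4 => exact ⟨_, _, .rel4, by simp only [LieHom.map_lie, map_T], map_zero f⟩
  case rel5 k hk hk' =>
    exact ⟨_, _, .rel5 k hk hk', by simp only [LieHom.map_lie, map_T],
      by simp only [map_smul, map_T]⟩
  case rel6 k hk hk' =>
    exact ⟨_, _, .rel6 k hk hk', by simp only [LieHom.map_lie, map_T], map_zero f⟩
  case path m k s₁ s₂ hm hm' hk hk' hmk hs hs₁ =>
    exact ⟨_, _, .path m k s₁ s₂ hm hm' hk hk' hmk hs hs₁, by simp only [map_iterAd, map_T],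
      by simp only [map_smul, map_T]⟩

theorem SatisfiesRelations.of_map_injective {f : L →ₗ⁅ℂ⁆ M} (hf : Function.Injective f) {d s : L}
    (h : SatisfiesRelations n (f d) (f s)) : SatisfiesRelations n d s :=
  fun _ _ hlr => hf (h (hlr.map f))

theorem relationIdeal_le_ker_iff {f : FreeLieAlgebra ℂ Gen →ₗ⁅ℂ⁆ L} :
    relationIdeal n ≤ f.ker ↔
      SatisfiesRelations n (f (FreeLieAlgebra.of ℂ Gen.D)) (f (FreeLieAlgebra.of ℂ Gen.S)) := by
  constructor
  · intro hle l r hlr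
    obtain ⟨l', r', hlr', rfl, rfl⟩ := hlr.exists_of_map f
    have : f (l' - r') = 0 :=
      LieHom.mem_ker.1 (hle (LieSubmodule.subset_lieSpan ⟨l', r', hlr', rfl⟩))
    rwa [map_sub, sub_eq_zero] at this
  · intro h
    refine LieSubmodule.lieSpan_le.2 ?_
    rintro _ ⟨l, r, hlr, rfl⟩
    exact LieHom.mem_ker.2 (by rw [map_sub, h (hlr.map f), sub_self])

/-- The morphism from the free Lie algebra on the two letters that sends them to `d` and `s`. -/
noncomputable def evalHom (d s : L) : FreeLieAlgebra ℂ Gen →ₗ⁅ℂ⁆ L :=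
  FreeLieAlgebra.lift ℂ fun
    | Gen.D => d
    | Gen.S => s

theorem evalHom_of_D (d s : L) : evalHom d s (FreeLieAlgebra.of ℂ Gen.D) = d :=
  FreeLieAlgebra.lift_of_apply _ _

theorem evalHom_of_S (d s : L) : evalHom d s (FreeLieAlgebra.of ℂ Gen.S) = s :=
  FreeLieAlgebra.lift_of_apply _ _

theorem eq_evalHom (f : FreeLieAlgebra ℂ Gen →ₗ⁅ℂ⁆ L) :
    f = evalHom (f (FreeLieAlgebra.of ℂ Gen.D)) (f (FreeLieAlgebra.of ℂ Gen.S)) :=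
  FreeLieAlgebra.hom_ext fun
    | Gen.D => (evalHom_of_D _ _).symm
    | Gen.S => (evalHom_of_S _ _).symm

theorem range_evalHom (d s : L) :
    (evalHom d s).range = LieSubalgebra.lieSpan ℂ L {d, s} := by
  rw [evalHom, range_freeLieAlgebra_lift]
  congr 1
  ext x
  constructor
  · rintro ⟨_ | _, rfl⟩
    · exact Or.inl rfl
    · exact Or.inr rfl
  · rintro (rfl | rfl)
    · exact ⟨Gen.D, rfl⟩
    · exact ⟨Gen.S, rfl⟩

theorem span_basisFamily_quotient_relationIdeal (hn : 2 ≤ n) :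
    Submodule.span ℂ (Set.range (basisFamily n
      (quotientMk (relationIdeal n) (FreeLieAlgebra.of ℂ Gen.D))
      (quotientMk (relationIdeal n) (FreeLieAlgebra.of ℂ Gen.S)))) = ⊤ := by
  refine SatisfiesRelations.span_basisFamily_eq_top
    (relationIdeal_le_ker_iff.1 (ker_quotientMk _).ge) hn ?_
  rw [← range_evalHom, ← eq_evalHom, range_quotientMk]

theorem relationIdeal_eq_ker_evalHom (hn : 2 ≤ n) {d s : L} (h : SatisfiesRelations n d s)
    (hli : LinearIndependent ℂ (basisFamily n d s)) :
    relationIdeal n = (evalHom d s).ker := by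
  set f := evalHom d s with hf
  have hle : relationIdeal n ≤ f.ker :=
    relationIdeal_le_ker_iff.2 (by rwa [hf, evalHom_of_D, evalHom_of_S])
  refine le_antisymm hle fun x hx => ?_
  set π := quotientMk (relationIdeal n)
  let g : (FreeLieAlgebra ℂ Gen ⧸ relationIdeal n) →ₗ[ℂ] L :=
    (relationIdeal n).toSubmodule.liftQ f.toLinearMap hle
  have hgπ : g ∘ π = f := rfl
  have hg : g ∘ basisFamily n (π (FreeLieAlgebra.of ℂ Gen.D)) (π (FreeLieAlgebra.of ℂ Gen.S)) =
      basisFamily n d s := by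
    rw [← map_basisFamily, ← Function.comp_assoc, hgπ, map_basisFamily, hf, evalHom_of_D,
      evalHom_of_S]
  have hker : LinearMap.ker g = ⊥ := by
    have := Submodule.range_ker_disjoint (hg ▸ hli)
    rwa [span_basisFamily_quotient_relationIdeal hn, top_disjoint] at this
  have hπx : π x = 0 := LinearMap.ker_eq_bot'.1 hker _ (LieHom.mem_ker.1 hx)
  rwa [← LieHom.mem_ker, ker_quotientMk] at hπx

theorem exists_relationIdeal_quotient_equiv (hn : 2 ≤ n) {d s : L} (h : SatisfiesRelations n d s)
    (hli : LinearIndependent ℂ (basisFamily n d s))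
    (hgen : LieSubalgebra.lieSpan ℂ L {d, s} = ⊤) :
    ∃ e : (FreeLieAlgebra ℂ Gen ⧸ relationIdeal n) ≃ₗ⁅ℂ⁆ L,
      e (LieSubmodule.Quotient.mk (FreeLieAlgebra.of ℂ Gen.D)) = d ∧
      e (LieSubmodule.Quotient.mk (FreeLieAlgebra.of ℂ Gen.S)) = s := by
  obtain ⟨e, he⟩ := exists_quotient_equiv (relationIdeal_eq_ker_evalHom hn h hli)
    ((range_evalHom d s).trans hgen)
  exact ⟨e, (he _).trans (evalHom_of_D d s), (he _).trans (evalHom_of_S d s)⟩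

end RelationIdeal

section QCommute

variable {R A : Type*} [CommRing R] [Ring A] [Algebra R A]

/-- Two elements of an algebra `q`-commute if `s * d = q • (d * s)`, as the shift and clock
matrices do for `q = exp(2πi/n)`. -/
def QCommute (q : R) (d s : A) : Prop := s * d = q • (d * s)

namespace QCommute

variable {q : R} {d s : A}

theorem pow_left (h : QCommute q d s) (k : ℕ) : QCommute (q ^ k) (d ^ k) s := by
  induction k with
  | zero => simp [QCommute]
  | succ k ih =>
    rw [QCommute] at *
    rw [pow_succ, ← mul_assoc, ih, smul_mul_assoc, mul_assoc, h, mul_smul_comm, smul_smul,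
      mul_assoc, pow_succ]

theorem pow_right (h : QCommute q d s) (m : ℕ) : QCommute (q ^ m) d (s ^ m) := by
  induction m with
  | zero => simp [QCommute]
  | succ m ih =>
    rw [QCommute] at *
    rw [pow_succ', mul_assoc, ih, mul_smul_comm, ← mul_assoc, h, smul_mul_assoc, smul_smul,
      mul_assoc, pow_succ]

theorem mul_monomial (h : QCommute q d s) (k m : ℕ) :
    s * (d ^ k * s ^ m) = q ^ k • (d ^ k * s ^ (m + 1)) := by
  rw [← mul_assoc, h.pow_left k, smul_mul_assoc, mul_assoc, ← pow_succ']

theorem monomial_mul (h : QCommute q d s) (k m : ℕ) :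
    d ^ k * s ^ m * d = q ^ m • (d ^ (k + 1) * s ^ m) := by
  rw [mul_assoc, h.pow_right m, mul_smul_comm, ← mul_assoc, ← pow_succ]

end QCommute

theorem linearIndependent_of_simultaneous_eigenvectors {κ ι M : Type*} [IsDomain R]
    [AddCommGroup M] [Module R M] [Module.IsTorsionFree R M] (f : κ → Module.End R M)
    (hf : ∀ a b, Commute (f a) (f b)) {χ : ι → κ → R} (hχ : Function.Injective χ) {v : ι → M}
    (hv : ∀ i a, f a (v i) = χ i a • v i) (hv0 : ∀ i, v i ≠ 0) : LinearIndependent R v := by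
  have hindep := Module.End.independent_iInf_maxGenEigenspace_of_forall_mapsTo f fun a b φ =>
    Module.End.mapsTo_maxGenEigenspace_of_comm (hf b a) φ
  refine (hindep.comp hχ).linearIndependent _ (fun i => ?_) hv0
  exact (Submodule.mem_iInf _).2 fun a => Module.End.genEigenspace_le_maximal _ _ 1
    (Module.End.mem_eigenspace_iff.2 (hv i a))

namespace QCommute

variable {q : R} {d s : Aˣ}

theorem commute_mulLeftRight (h : QCommute q (d : A) s) :
    Commute (LinearMap.mulLeftRight R ((s : A), (↑s⁻¹ : A)))
      (LinearMap.mulLeftRight R ((↑d⁻¹ : A), (d : A))) := by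
  have hds : (↑d⁻¹ * s : A) = q • (s * ↑d⁻¹) := by
    rw [Units.inv_mul_eq_iff_eq_mul, mul_smul_comm, ← mul_assoc, ← smul_mul_assoc, ← h,
      Units.mul_inv_cancel_right]
  have hsd : (d * ↑s⁻¹ : A) = q • (↑s⁻¹ * d) := by
    rw [Units.mul_inv_eq_iff_eq_mul, smul_mul_assoc, mul_assoc, ← mul_smul_comm, ← h,
      Units.inv_mul_cancel_left]
  ext x
  calc (s : A) * (↑d⁻¹ * x * d) * ↑s⁻¹ = s * ↑d⁻¹ * x * (d * ↑s⁻¹) := by simp only [mul_assoc]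
    _ = ↑d⁻¹ * s * x * (↑s⁻¹ * d) := by
      rw [hsd, hds, mul_smul_comm, smul_mul_assoc, smul_mul_assoc]
    _ = ↑d⁻¹ * (s * x * ↑s⁻¹) * d := by simp only [mul_assoc]

theorem linearIndependent {ι : Type*} [IsDomain R] [Nontrivial A] [Module.IsTorsionFree R A]
    (h : QCommute q (d : A) s) {k m : ι → ℕ}
    (hinj : Function.Injective fun i => (q ^ k i, q ^ m i)) :
    LinearIndependent R fun i => (d : A) ^ k i * (s : A) ^ m i := by
  have hs (k m : ℕ) : s * ((d : A) ^ k * s ^ m) * ↑s⁻¹ = q ^ k • ((d : A) ^ k * s ^ m) := by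
    rw [h.mul_monomial, smul_mul_assoc, pow_succ, ← mul_assoc, Units.mul_inv_cancel_right]
  have hd (k m : ℕ) : ↑d⁻¹ * ((d : A) ^ k * s ^ m) * d = q ^ m • ((d : A) ^ k * s ^ m) := by
    rw [mul_assoc, h.monomial_mul, mul_smul_comm, pow_succ', mul_assoc,
      Units.inv_mul_cancel_left]
  refine linearIndependent_of_simultaneous_eigenvectors
    (f := ![LinearMap.mulLeftRight R ((s : A), ↑s⁻¹), LinearMap.mulLeftRight R (↑d⁻¹, (d : A))])
    (χ := fun i => ![q ^ k i, q ^ m i]) ?_ ?_ ?_ ?_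
  · simp [Fin.forall_fin_two, h.commute_mulLeftRight, h.commute_mulLeftRight.symm]
  · exact fun i j hij => hinj (Prod.ext (congrFun hij 0) (congrFun hij 1))
  · simp [Fin.forall_fin_two, hs, hd]
  · exact fun i => (d ^ k i * s ^ m i).ne_zero

end QCommute

end QCommute

section Exponents

theorem rootA_isPrimitiveRoot {n : ℕ} (hn : n ≠ 0) : IsPrimitiveRoot (rootA n) n :=
  Complex.isPrimitiveRoot_exp n hn

theorem one_sub_pow_ne_zero_of_isPrimitiveRoot {R : Type*} [CommRing R] {q : R} {n k : ℕ}
    (hq : IsPrimitiveRoot q n) (hk : k ≠ 0) (hkn : k < n) : 1 - q ^ k ≠ 0 :=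
  sub_ne_zero.2 (hq.pow_ne_one_of_pos_of_lt hk hkn).symm

theorem pow_injOn_Icc_of_isPrimitiveRoot {M : Type*} [CommMonoid M] {q : M} {n : ℕ}
    (hq : IsPrimitiveRoot q n) : Set.InjOn (q ^ ·) (Set.Icc 1 n) := by
  rintro k ⟨hk, hkn⟩ k' ⟨hk', hkn'⟩ h
  obtain ⟨k, rfl⟩ := Nat.exists_eq_add_of_le' hk
  obtain ⟨k', rfl⟩ := Nat.exists_eq_add_of_le' hk'
  simp only [pow_succ] at h
  rw [hq.pow_inj (by omega) (by omega) ((hq.isUnit (by omega)).mul_right_cancel h)]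

/-- The exponents `(m, k)` for which the member of the basis is a multiple of `d ^ k * s ^ m`.
Since `d ^ n = s ^ n = 1`, the letters `d = d * s ^ n` and `s = d ^ n * s` fill the slots
`(n, 1)` and `(1, n)` that are missing from `BasisIndex n`. -/
def exponents (n : ℕ) : Gen ⊕ BasisIndex n → ℕ × ℕ
  | Sum.inl Gen.D => (n, 1)
  | Sum.inl Gen.S => (1, n)
  | Sum.inr p => p.1

theorem exponents_injective {n : ℕ} (hn : 2 ≤ n) : Function.Injective (exponents n) := by
  rintro ((_ | _) | ⟨⟨m, k⟩, hm, hk, h₁, h₂⟩) ((_ | _) | ⟨⟨m', k'⟩, hm', hk', h₁', h₂'⟩) h <;>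
    simp only [exponents, Prod.mk.injEq] at * <;> first | omega | grind

theorem range_exponents {n : ℕ} (hn : 2 ≤ n) :
    Set.range (exponents n) =
      ((Finset.Icc 1 n ×ˢ Finset.Icc 1 n).erase (n, n) : Finset (ℕ × ℕ)) := by
  ext ⟨m, k⟩
  simp only [Finset.coe_erase, Set.mem_sdiff, Finset.mem_coe, Finset.mem_product, Finset.mem_Icc,
    Set.mem_singleton_iff, Prod.mk.injEq]
  constructor
  · rintro ⟨(_ | _) | p, hp⟩
    · obtain ⟨rfl, rfl⟩ := Prod.mk.inj hp
      omega
    · obtain ⟨rfl, rfl⟩ := Prod.mk.inj hp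
      omega
    · have hp' := p.2
      rw [show p.1 = (m, k) from hp] at hp'
      omega
  · intro h
    by_cases hD : m = n ∧ k = 1
    · exact ⟨Sum.inl Gen.D, Prod.ext hD.1.symm hD.2.symm⟩
    by_cases hS : m = 1 ∧ k = n
    · exact ⟨Sum.inl Gen.S, Prod.ext hS.1.symm hS.2.symm⟩
    · exact ⟨Sum.inr ⟨(m, k), by dsimp only; omega⟩, rfl⟩

theorem card_gen_sum_basisIndex {n : ℕ} (hn : 2 ≤ n) :
    Nat.card (Gen ⊕ BasisIndex n) + 1 = n ^ 2 := by
  have hmem : (n, n) ∈ Finset.Icc 1 n ×ˢ Finset.Icc 1 n := by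
    simp only [Finset.mem_product, Finset.mem_Icc]
    omega
  rw [← Nat.card_range_of_injective (exponents_injective hn), range_exponents hn,
    Nat.card_coe_set_eq, Set.ncard_coe_finset, Finset.card_erase_add_one hmem,
    Finset.card_product, Nat.card_Icc, Nat.add_sub_cancel, sq]

theorem pow_exponents_injective {M : Type*} [CommMonoid M] {q : M} {n : ℕ} (hn : 2 ≤ n)
    (hq : IsPrimitiveRoot q n) :
    Function.Injective fun i => (q ^ (exponents n i).2, q ^ (exponents n i).1) := by
  have hmem (i) : (exponents n i).1 ∈ Set.Icc 1 n ∧ (exponents n i).2 ∈ Set.Icc 1 n := by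
    have hi := (range_exponents hn).le (Set.mem_range_self i)
    simpa using Finset.mem_of_mem_erase (Finset.mem_coe.1 hi)
  intro i j hij
  obtain ⟨h₂, h₁⟩ := Prod.mk.inj hij
  exact exponents_injective hn <| Prod.ext
    (pow_injOn_Icc_of_isPrimitiveRoot hq (hmem i).1 (hmem j).1 h₁)
    (pow_injOn_Icc_of_isPrimitiveRoot hq (hmem i).2 (hmem j).2 h₂)

end Exponents

section Brackets

attribute [local instance] LieRing.ofAssociativeRing

namespace QCommute

theorem lie_left {R A : Type*} [CommRing R] [Ring A] [Algebra R A] {q : R} {d s : A}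
    (h : QCommute q d s) (k m : ℕ) :
    ⁅d, d ^ k * s ^ m⁆ = (1 - q ^ m) • (d ^ (k + 1) * s ^ m) := by
  rw [Ring.lie_def, h.monomial_mul, ← mul_assoc, ← pow_succ', sub_smul, one_smul]

theorem lie_right {R A : Type*} [CommRing R] [Ring A] [Algebra R A] {q : R} {d s : A}
    (h : QCommute q d s) (k m : ℕ) :
    ⁅s, d ^ k * s ^ m⁆ = (-(1 - q ^ k)) • (d ^ k * s ^ (m + 1)) := by
  rw [Ring.lie_def, h.mul_monomial, mul_assoc, ← pow_succ, neg_sub, sub_smul, one_smul]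

variable {A : Type*} [Ring A] [Algebra ℂ A] {q : ℂ} {d s : A}

theorem iterAd_left (h : QCommute q d s) (j k m : ℕ) :
    iterAd d j (d ^ k * s ^ m) = (1 - q ^ m) ^ j • (d ^ (k + j) * s ^ m) := by
  induction j with
  | zero => rw [iterAd_zero, pow_zero, one_smul, add_zero]
  | succ j ih => rw [iterAd_succ, ih, lie_smul, h.lie_left, smul_smul, ← pow_succ, add_assoc]

theorem iterAd_right (h : QCommute q d s) (j k m : ℕ) :
    iterAd s j (d ^ k * s ^ m) = (-(1 - q ^ k)) ^ j • (d ^ k * s ^ (m + j)) := by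
  induction j with
  | zero => rw [iterAd_zero, pow_zero, one_smul, add_zero]
  | succ j ih => rw [iterAd_succ, ih, lie_smul, h.lie_right, smul_smul, ← pow_succ, add_assoc]

theorem lie_eq (h : QCommute q d s) : ⁅d, s⁆ = (1 - q) • (d ^ 1 * s ^ 1) := by
  simpa using h.lie_left 0 1

theorem iterAd_right_lie (h : QCommute q d s) (m : ℕ) :
    iterAd s m ⁅d, s⁆ = ((-1) ^ m * (1 - q) ^ (m + 1)) • (d ^ 1 * s ^ (m + 1)) := by
  rw [h.lie_eq, iterAd_smul, h.iterAd_right, smul_smul, pow_one q, neg_pow, add_comm 1 m]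
  ring_nf

theorem T_succ_succ (h : QCommute q d s) {n m : ℕ} (hmn : m + 1 ≠ n) (k : ℕ) :
    T n d s (m + 1) (k + 1) =
      ((-1) ^ m * (1 - q) ^ (m + 1) * (1 - q ^ (m + 1)) ^ k) •
        (d ^ (k + 1) * s ^ (m + 1)) := by
  rw [T_of_ne hmn, Nat.add_sub_cancel, Nat.add_sub_cancel, h.iterAd_right_lie, iterAd_smul,
    h.iterAd_left, smul_smul, add_comm 1 k]

theorem T_top_succ (h : QCommute q d s) (m k : ℕ) :
    T (m + 2) d s (m + 2) (k + 1) =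
      ((-1) ^ (m + 1) * (1 - q) ^ (m + 1) * (1 - q ^ (m + 1)) ^ k * (1 - q ^ (k + 1))) •
        (d ^ (k + 1) * s ^ (m + 2)) := by
  rw [T_self (by omega), show m + 2 - 1 = m + 1 by omega, h.T_succ_succ (by omega), lie_smul,
    h.lie_right, smul_smul]
  congr 1
  ring

theorem iterAd_right_iterAd_left_iterAd_right_lie (h : QCommute q d s) {n a b : ℕ}
    (hn : a + b + 1 ≠ n) (hq : 1 - q ≠ 0) (hqab : 1 - q ^ (a + b + 1) ≠ 0) (k : ℕ) :
    iterAd s a (iterAd d k (iterAd s b ⁅d, s⁆)) =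
      (((1 - q ^ (k + 1)) / (1 - q)) ^ a * ((1 - q ^ (b + 1)) / (1 - q ^ (a + b + 1))) ^ k) •
        T n d s (a + b + 1) (k + 1) := by
  rw [h.T_succ_succ hn, h.iterAd_right_lie, iterAd_smul, h.iterAd_left, iterAd_smul, iterAd_smul,
    h.iterAd_right, smul_smul, smul_smul, smul_smul, add_comm 1 k, add_right_comm b 1 a,
    add_comm b a, neg_pow (1 - q ^ (k + 1)), div_pow, div_pow]
  congr 1
  field_simp
  ring

end QCommute

/-- Generators of the algebra of the clock and shift matrices: two `q`-commuting elements whose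
`n`-th powers are `1`. -/
structure IsWeylPair {A : Type*} [Ring A] [Algebra ℂ A] (q : ℂ) (n : ℕ) (d s : A) : Prop where
  qCommute : QCommute q d s
  left_pow : d ^ n = 1
  right_pow : s ^ n = 1

namespace IsWeylPair

variable {A : Type*} [Ring A] [Algebra ℂ A] {q : ℂ} {n : ℕ} {d s : A}

theorem iterAd_left (h : IsWeylPair q n d s) (k m : ℕ) :
    iterAd d n (d ^ k * s ^ m) = (1 - q ^ m) ^ n • (d ^ k * s ^ m) := by
  rw [h.qCommute.iterAd_left, pow_add, h.left_pow, mul_one]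

theorem iterAd_left_self (h : IsWeylPair q n d s) : iterAd d n s = (1 - q) ^ n • s := by
  simpa using h.iterAd_left 0 1

theorem iterAd_left_iterAd_right_lie (h : IsWeylPair q n d s) (m : ℕ) :
    iterAd d n (iterAd s m ⁅d, s⁆) = (1 - q ^ (m + 1)) ^ n • iterAd s m ⁅d, s⁆ := by
  rw [h.qCommute.iterAd_right_lie, iterAd_smul, h.iterAd_left, smul_comm]

theorem T_top_succ {m : ℕ} (h : IsWeylPair q (m + 2) d s) (k : ℕ) :
    T (m + 2) d s (m + 2) (k + 1) =
      ((-1) ^ (m + 1) * (1 - q) ^ (m + 1) * (1 - q ^ (m + 1)) ^ k * (1 - q ^ (k + 1))) •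
        d ^ (k + 1) := by
  rw [h.qCommute.T_top_succ, h.right_pow, mul_one]

theorem T_top_one {m : ℕ} (h : IsWeylPair q (m + 2) d s) :
    T (m + 2) d s (m + 2) 1 = ((-1) ^ (m + 1) * (1 - q) ^ (m + 2)) • d := by
  rw [h.T_top_succ 0]
  simp only [pow_zero, zero_add, pow_one, mul_one]
  rw [mul_assoc, ← pow_succ]

theorem T_top_top {m : ℕ} (h : IsWeylPair q (m + 2) d s) (hq : q ^ (m + 2) = 1) :
    T (m + 2) d s (m + 2) (m + 2) = 0 := by
  rw [h.T_top_succ (m + 1), hq, sub_self, mul_zero, zero_smul]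

theorem lie_left_T_top {m : ℕ} (h : IsWeylPair q (m + 2) d s) (k : ℕ) :
    ⁅d, T (m + 2) d s (m + 2) (k + 1)⁆ = 0 := by
  rw [h.T_top_succ, lie_smul, ((Commute.refl d).pow_right (k + 1)).lie_eq, smul_zero]

theorem lie_right_T_top {j r : ℕ} (h : IsWeylPair q (j + r + 2) d s) :
    ⁅s, T (j + r + 2) d s (j + r + 2) (j + 1)⁆ =
      ((-1) ^ (j + r + 2) * (1 - q ^ (j + 1)) ^ 2 * (1 - q ^ (j + r + 1)) ^ j * (1 - q) ^ r) •
        T (j + r + 2) d s 1 (j + 1) := by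
  have hlie : ⁅s, d ^ (j + 1)⁆ = (-(1 - q ^ (j + 1))) • (d ^ (j + 1) * s ^ (0 + 1)) := by
    simpa using h.qCommute.lie_right (j + 1) 0
  have hT : T (j + r + 2) d s 1 (j + 1) = _ := h.qCommute.T_succ_succ (m := 0) (by omega) j
  rw [h.T_top_succ, lie_smul, hlie, hT, smul_smul, smul_smul]
  congr 1
  ring

theorem satisfiesRelations (hn : 2 ≤ n) (h : IsWeylPair (rootA n) n d s) :
    SatisfiesRelations n d s := by
  have hq := rootA_isPrimitiveRoot (n := n) (by omega)
  obtain ⟨p, rfl⟩ := Nat.exists_eq_add_of_le' hn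
  intro l r hlr
  cases hlr
  case rel1 => exact h.iterAd_left_self
  case rel2 m hm hm' =>
    obtain ⟨m, rfl⟩ := Nat.exists_eq_add_of_le' (by omega : 1 ≤ m)
    exact h.iterAd_left_iterAd_right_lie m
  case rel3 =>
    rw [← T_self hn]
    exact h.T_top_one
  case rel4 =>
    rw [← T_self hn]
    exact h.T_top_top hq.pow_eq_one
  case rel5 k hk hk' =>
    obtain ⟨j, rfl⟩ := Nat.exists_eq_add_of_le' (by omega : 1 ≤ k)
    obtain ⟨r, rfl⟩ := Nat.exists_eq_add_of_le (by omega : j ≤ p)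
    rw [show j + r + 2 - (j + 1) - 1 = r by omega]
    exact h.lie_right_T_top
  case rel6 k hk hk' =>
    obtain ⟨k, rfl⟩ := Nat.exists_eq_add_of_le' (by omega : 1 ≤ k)
    exact h.lie_left_T_top k
  case path m k a b hm hm' hk hk' hmk hab ha =>
    obtain ⟨k, rfl⟩ := Nat.exists_eq_add_of_le' hk
    obtain rfl : m = a + b + 1 := by omega
    rw [T_one_one hn]
    exact h.qCommute.iterAd_right_iterAd_left_iterAd_right_lie (by omega)
      (sub_ne_zero.2 (hq.ne_one (by omega)).symm)
      (one_sub_pow_ne_zero_of_isPrimitiveRoot hq (by omega) (by omega)) k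

theorem exists_basisFamily_eq_smul (h : IsWeylPair q n d s) (hn : 2 ≤ n)
    (hq : IsPrimitiveRoot q n) (i : Gen ⊕ BasisIndex n) :
    ∃ c : ℂˣ, basisFamily n d s i = c • (d ^ (exponents n i).2 * s ^ (exponents n i).1) := by
  suffices ∃ c : ℂ, c ≠ 0 ∧
      basisFamily n d s i = c • (d ^ (exponents n i).2 * s ^ (exponents n i).1) by
    obtain ⟨c, hc, hi⟩ := this
    exact ⟨Units.mk0 c hc, hi⟩
  have hne {k : ℕ} (hk : k ≠ 0) (hkn : k < n) : 1 - q ^ k ≠ 0 :=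
    one_sub_pow_ne_zero_of_isPrimitiveRoot hq hk hkn
  have hne1 : 1 - q ≠ 0 := pow_one q ▸ hne one_ne_zero (by omega)
  rcases i with (_ | _) | ⟨⟨m, k⟩, ⟨hm, hmn⟩, ⟨hk, hkn⟩, hkn', hk1⟩
  · exact ⟨1, one_ne_zero, by simp [basisFamily, exponents, h.right_pow]⟩
  · exact ⟨1, one_ne_zero, by simp [basisFamily, exponents, h.left_pow]⟩
  dsimp only at hm hmn hk hkn hkn'
  obtain ⟨m, rfl⟩ := Nat.exists_eq_add_of_le' hm
  obtain ⟨k, rfl⟩ := Nat.exists_eq_add_of_le' hk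
  obtain rfl | hmn := hmn.eq_or_lt
  · obtain ⟨m, rfl⟩ := Nat.exists_eq_add_of_le' (by omega : 1 ≤ m)
    refine ⟨_, ?_, h.qCommute.T_top_succ m k⟩
    simp [hne1, hne m.succ_ne_zero (by omega), hne k.succ_ne_zero (by omega)]
  · refine ⟨_, ?_, h.qCommute.T_succ_succ hmn.ne k⟩
    simp [hne1, hne m.succ_ne_zero hmn]

variable [Nontrivial A]

theorem linearIndependent_basisFamily (h : IsWeylPair q n d s) (hn : 2 ≤ n)
    (hq : IsPrimitiveRoot q n) : LinearIndependent ℂ (basisFamily n d s) := by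
  choose c hc using h.exists_basisFamily_eq_smul hn hq
  obtain ⟨d, rfl⟩ := IsUnit.of_pow_eq_one h.left_pow (by omega)
  obtain ⟨s, rfl⟩ := IsUnit.of_pow_eq_one h.right_pow (by omega)
  have hli := (h.qCommute.linearIndependent (pow_exponents_injective hn hq)).units_smul c
  rwa [show basisFamily n (d : A) s = _ from funext hc]

end IsWeylPair

end Brackets

section ClockAndShift

open LieAlgebra.SpecialLinear (sl)

attribute [local instance] LieRing.ofAssociativeRing

theorem finrank_sl_add_one (ι K : Type*) [Fintype ι] [DecidableEq ι] [Nonempty ι] [Field K] :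
    Module.finrank K (sl ι K) + 1 = Fintype.card ι ^ 2 := by
  have htrace : Matrix.traceLinearMap ι K K ≠ 0 := fun h => by
    obtain ⟨i⟩ := ‹Nonempty ι›
    simpa using LinearMap.congr_fun h (Matrix.single i i 1)
  have := Module.Dual.finrank_ker_add_one_of_ne_zero htrace
  rwa [Module.finrank_matrix, Module.finrank_self, mul_one, ← sq] at this

theorem shiftMatrix_pow_apply (n m : ℕ) (i j : Fin n) :
    (shiftMatrix n ^ m) i j = if (j : ℕ) = ((i : ℕ) + m) % n then 1 else 0 := by
  induction m generalizing j with
  | zero => simp [Matrix.one_apply, Nat.mod_eq_of_lt i.isLt, Fin.ext_iff, eq_comm]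
  | succ m ih =>
    have hlt : ((i : ℕ) + m) % n < n := Nat.mod_lt _ i.pos
    rw [pow_succ, Matrix.mul_apply, Finset.sum_eq_single ⟨((i : ℕ) + m) % n, hlt⟩]
    · rw [ih, if_pos rfl, one_mul]
      simp [shiftMatrix, add_assoc]
    · intro l _ hl
      rw [ih, if_neg (fun h => hl (Fin.ext h)), zero_mul]
    · simp

theorem shiftMatrix_pow_self (n : ℕ) : shiftMatrix n ^ n = 1 := by
  ext i j
  rw [shiftMatrix_pow_apply, Nat.add_mod_right, Nat.mod_eq_of_lt i.isLt, Matrix.one_apply]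
  simp only [Fin.ext_iff, eq_comm]

variable {n : ℕ}

theorem clockMatrix_pow_self (hn : n ≠ 0) : clockMatrix n ^ n = 1 := by
  rw [clockMatrix, Matrix.diagonal_pow, Matrix.diagonal_eq_one]
  funext i
  rw [Pi.pow_apply, pow_right_comm, (rootA_isPrimitiveRoot hn).pow_eq_one, one_pow, Pi.one_apply]

theorem qCommute_clockMatrix_shiftMatrix (hn : n ≠ 0) :
    QCommute (rootA n) (clockMatrix n) (shiftMatrix n) := by
  ext i j
  rw [clockMatrix, Matrix.mul_diagonal, Matrix.smul_apply, Matrix.diagonal_mul, shiftMatrix,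
    Matrix.of_apply, smul_eq_mul, ← mul_assoc, ← pow_succ']
  split_ifs with h
  · rw [one_mul, mul_one, h, ← pow_eq_pow_mod _ (rootA_isPrimitiveRoot hn).pow_eq_one]
  · rw [zero_mul, mul_zero]

theorem isWeylPair_clockMatrix_shiftMatrix (hn : n ≠ 0) :
    IsWeylPair (rootA n) n (clockMatrix n) (shiftMatrix n) :=
  ⟨qCommute_clockMatrix_shiftMatrix hn, clockMatrix_pow_self hn, shiftMatrix_pow_self n⟩

theorem satisfiesRelations_clock_shift (hn : 2 ≤ n) :
    SatisfiesRelations n (clock n hn) (shift n hn) :=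
  .of_map_injective (f := (sl (Fin n) ℂ).incl) Subtype.val_injective
    ((isWeylPair_clockMatrix_shiftMatrix (by omega)).satisfiesRelations hn)

theorem linearIndependent_basisFamily_clock_shift (hn : 2 ≤ n) :
    LinearIndependent ℂ (basisFamily n (clock n hn) (shift n hn)) := by
  have : Nonempty (Fin n) := ⟨⟨0, by omega⟩⟩
  refine LinearIndependent.of_comp (sl (Fin n) ℂ).incl.toLinearMap ?_
  have := (isWeylPair_clockMatrix_shiftMatrix (n := n) (by omega)).linearIndependent_basisFamily hn
    (rootA_isPrimitiveRoot (by omega))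
  exact map_basisFamily (sl (Fin n) ℂ).incl n (clock n hn) (shift n hn) ▸ this

theorem span_basisFamily_clock_shift (hn : 2 ≤ n) :
    Submodule.span ℂ (Set.range (basisFamily n (clock n hn) (shift n hn))) = ⊤ := by
  have : Nonempty (Fin n) := ⟨⟨0, by omega⟩⟩
  have hli := linearIndependent_basisFamily_clock_shift hn
  have : Fintype (Gen ⊕ BasisIndex n) := @Fintype.ofFinite _ hli.finite
  refine hli.span_eq_top_of_card_eq_finrank' ?_
  have hcard := card_gen_sum_basisIndex hn
  have hrank := finrank_sl_add_one (Fin n) ℂ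
  rw [Fintype.card_fin] at hrank
  rw [← Nat.card_eq_fintype_card]
  omega

end ClockAndShift

end Sylvester

/-- The clock and shift matrices generate `sl(n)` as a Lie algebra; `D`, `S` and the listed
iterated brackets are a basis; and `sl(n)` is the quotient of the free Lie algebra on two
generators by the ideal of the listed relations, the generators going to `D` and `S`. -/
theorem theorem1 (n : ℕ) (hn : 2 ≤ n) :
    LieSubalgebra.lieSpan ℂ (LieAlgebra.SpecialLinear.sl (Fin n) ℂ)
        {Sylvester.clock n hn, Sylvester.shift n hn} = ⊤ ∧
    (LinearIndependent ℂ
        (Sylvester.basisFamily n (Sylvester.clock n hn) (Sylvester.shift n hn)) ∧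
      Submodule.span ℂ (Set.range
        (Sylvester.basisFamily n (Sylvester.clock n hn) (Sylvester.shift n hn))) = ⊤) ∧
    ∃ e : (FreeLieAlgebra ℂ Sylvester.Gen ⧸ Sylvester.relationIdeal n) ≃ₗ⁅ℂ⁆
        LieAlgebra.SpecialLinear.sl (Fin n) ℂ,
      e (LieSubmodule.Quotient.mk (FreeLieAlgebra.of ℂ Sylvester.Gen.D)) =
        Sylvester.clock n hn ∧
      e (LieSubmodule.Quotient.mk (FreeLieAlgebra.of ℂ Sylvester.Gen.S)) =
        Sylvester.shift n hn := by
  have hspan := Sylvester.span_basisFamily_clock_shift hn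
  have hli := Sylvester.linearIndependent_basisFamily_clock_shift hn
  have hgen := Sylvester.lieSpan_eq_top_of_span_basisFamily_eq_top hspan
  exact ⟨hgen, ⟨hli, hspan⟩, Sylvester.exists_relationIdeal_quotient_equiv hn
    (Sylvester.satisfiesRelations_clock_shift hn) hli hgen⟩
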